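/- Let $k$ be an algebraically closed field, $n\ge 0$, and let $X\subsetneq\mathbb P^n_k$ be a proper closed subvariety, i.e. an integral closed subscheme different from $\mathbb P^n_k$. Let $\deg(X)$ be its degree, that is, $d!$ times the leading coefficient of the Hilbert polynomial of the homogeneous coordinate ring of $X$, where $d=\dim X$ is the degree of this polynomial. Then there exist an integer $r$ and homogeneous polynomials $f_1,\dots,f_r\in k[x_0,\dots,x_n]$ of positive degrees, all at most $\deg(X)$, such that the closed subscheme $W=V_+(f_1,\dots,f_r)\subseteq\mathbb P^n_k$ is a complete intersection, i.e. has dimension $n-r$, and $X$ is an irreducible component of $W$ (as a closed subset). -/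

import Mathlib

open AlgebraicGeometry CategoryTheory

universe u

noncomputable section

/-- The standard grading of `k[x₀, …, xₙ]` by degree. -/
abbrev stdGrading (k : Type u) [Field k] (n : ℕ) :
    ℕ → Submodule k (MvPolynomial (Fin (n + 1)) k) :=
  MvPolynomial.homogeneousSubmodule (Fin (n + 1)) k

instance stdGrading.gradedAlgebra (k : Type u) [Field k] (n : ℕ) :
    GradedAlgebra (stdGrading k n) :=
  MvPolynomial.gradedAlgebra

/-- Projective `n`-space `Proj k[x₀, …, xₙ]` over `k`, as a scheme. -/
abbrev projSpace (k : Type u) [Field k] (n : ℕ) : Scheme.{u} :=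
  Proj (stdGrading k n)

variable {k : Type u} [Field k] {n : ℕ}

/-- The Hilbert function `m ↦ dim_k (S / I)_m` of an ideal `I` of `S = k[x₀, …, xₙ]`; here
`(S / I)_m` is the image of the space of forms of degree `m`. -/
def hilbertFunction (I : Ideal (MvPolynomial (Fin (n + 1)) k)) (m : ℕ) : ℕ :=
  Module.finrank k ((stdGrading k n m).map (Ideal.Quotient.mkₐ k I).toLinearMap)

/-- `P` is the Hilbert polynomial of `S / I`: it takes the values of the Hilbert function at all
large integers. At most one polynomial has this property. -/
def IsHilbertPolynomial (I : Ideal (MvPolynomial (Fin (n + 1)) k)) (P : Polynomial ℚ) : Prop :=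
  ∀ᶠ m : ℕ in Filter.atTop, P.eval (m : ℚ) = hilbertFunction I m

open Classical in
/-- The Hilbert polynomial of `S / I` (with value `0` if there were none). -/
def hilbertPolynomial (I : Ideal (MvPolynomial (Fin (n + 1)) k)) : Polynomial ℚ :=
  if h : ∃ P, IsHilbertPolynomial I P then h.choose else 0

/-- The degree of a closed subvariety of `ℙⁿ`, given as a closed immersion `i : X ⟶ ℙⁿ` with `X`
integral: `d!` times the leading coefficient of the Hilbert polynomial of `S / I(X)`, where `d` is
the degree of that polynomial. Since `X` is reduced, its homogeneous ideal `I(X)` is the ideal of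
all polynomials vanishing on the points of `X`. -/
def subvarietyDegree {X : Scheme.{u}} [IsIntegral X] (i : X ⟶ projSpace k n)
    [IsClosedImmersion i] : ℚ :=
  let P := hilbertPolynomial
    (ProjectiveSpectrum.vanishingIdeal (𝒜 := stdGrading k n) (Set.range i)).toIdeal
  (P.natDegree.factorial : ℚ) * P.leadingCoeff

/-- The closed subset `V₊(f₁, …, f_r)` of `ℙⁿ`. -/
def projZeroLocus {r : ℕ} (f : Fin r → MvPolynomial (Fin (n + 1)) k) : Set (projSpace k n) :=
  ProjectiveSpectrum.zeroLocus (stdGrading k n) (Set.range f)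

/-- The forms `f₁, …, f_r` of positive degrees `e₁, …, e_r` define a complete intersection in `ℙⁿ`:
their common zero locus has dimension `n - r` (in particular it is nonempty and `r ≤ n`). -/
structure IsCompleteIntersection {r : ℕ} (f : Fin r → MvPolynomial (Fin (n + 1)) k)
    (e : Fin r → ℕ) : Prop where
  isHomogeneous : ∀ j, (f j).IsHomogeneous (e j)
  degree_pos : ∀ j, 0 < e j
  dim_add : topologicalKrullDim (projZeroLocus f) + (r : WithBot ℕ∞) = (n : WithBot ℕ∞)

end

/-!
# Subvarieties as components of complete intersections of bounded degree

Let `S = k[x₀, …, xₙ]`, let `P ⊆ S` be the homogeneous prime ideal of `X`, and `d = dim X`. As `k`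
is infinite, graded Noether normalization (`exists_linear_noether_normalization`) gives linear forms
`y₀, …, y_d`, algebraically independent modulo `P`, such that `S / P` is integral over
`A = k[y₀, …, y_d]`. Complete them by linear forms `z₁, …, z_r`, `r = n - d`, to a coordinate system.

As `A` is normal, the minimal polynomial `G_j` of `z_j` modulo `P` over the fraction field of `A` has
coefficients in `A`, and it may be taken homogeneous (`exists_isMonicForm_minimal`). The equations
are `f_j = G_j(y, z_j) ∈ P`.

* Since `G_j` is monic in `z_j`, the ring `S / (f₁, …, f_r)` is integral over `A`. By incomparability
  and going up, `V₊(f₁, …, f_r)` has dimension `d = n - r` (`topologicalKrullDim_zeroLocus_eq`), and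
  since `P ∩ A = 0` no prime containing `(f₁, …, f_r)` is properly contained in `P`, so `X` is a
  component (`closure_mem_irreducibleComponents_zeroLocus`).
* Let `e = deg G_j`. The powers `1, z_j, …, z_j ^ (e - 1)` are linearly independent over `A` modulo
  `P`, so the Hilbert function of `S / P` is at least `e` times a polynomial with leading term
  `m ^ d / d!` (`mul_choose_le_hilbertFunction`). As the `y` are a system of parameters, it is
  `O(m ^ d)` (`hilbertFunction_le`). Comparing with the Hilbert polynomial, whose existence is
  `exists_isHilbertPolynomial`, gives `e ≤ deg X`
  (`le_factorial_mul_leadingCoeff_hilbertPolynomial`).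
-/

noncomputable section

variable {k : Type u} [Field k] {n : ℕ}

/-! ### Homogeneous components -/

namespace MvPolynomial

variable {σ R : Type*} [CommSemiring R]

theorem homogeneousComponent_mul_of_isHomogeneous {ℓ : MvPolynomial σ R} {d : ℕ}
    (hℓ : ℓ.IsHomogeneous d) (b : MvPolynomial σ R) (m : ℕ) :
    homogeneousComponent (m + d) (b * ℓ) = homogeneousComponent m b * ℓ := by
  conv_lhs => rw [← sum_homogeneousComponent b]
  rw [Finset.sum_mul, map_sum]
  have h (i : ℕ) : homogeneousComponent (m + d) (homogeneousComponent i b * ℓ) =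
      if m = i then homogeneousComponent i b * ℓ else 0 := by
    rw [homogeneousComponent_of_mem ((homogeneousComponent_isHomogeneous i b).mul hℓ)]
    simp
  simp_rw [h]
  rw [Finset.sum_ite_eq]
  split_ifs with hm
  · rfl
  · rw [homogeneousComponent_eq_zero _ _ (by simpa using hm), zero_mul]

theorem mem_of_forall_X_mem {I : Ideal (MvPolynomial σ R)} (hX : ∀ i, X i ∈ I)
    {p : MvPolynomial σ R} (hp : coeff 0 p = 0) : p ∈ I := by
  rw [p.as_sum]
  refine Ideal.sum_mem _ fun d hd => ?_
  obtain ⟨i, hi⟩ : ∃ i, d i ≠ 0 := by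
    by_contra! h0
    rw [show d = 0 from Finsupp.ext h0, mem_support_iff] at hd
    exact hd hp
  exact Ideal.mem_of_dvd _ (X_dvd_monomial.mpr (Or.inr hi)) (hX i)

theorem IsHomogeneous.coeff_zero_eq_zero {p : MvPolynomial σ R} {m : ℕ} (hp : p.IsHomogeneous m)
    (hm : 0 < m) : coeff 0 p = 0 :=
  hp.coeff_eq_zero (by simpa using hm.ne)

end MvPolynomial

/-! ### The Hilbert function and linear forms -/

theorem Submodule.finrank_map_add_finrank_inf_ker {V V' : Type*} [AddCommGroup V] [Module k V]
    [AddCommGroup V'] [Module k V'] (f : V →ₗ[k] V') (W : Submodule k V) [FiniteDimensional k W] :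
    Module.finrank k (W.map f) + Module.finrank k (W ⊓ LinearMap.ker f : Submodule k V) =
      Module.finrank k W := by
  have h := LinearMap.finrank_range_add_finrank_ker (f.domRestrict W)
  rw [LinearMap.range_domRestrict, LinearMap.ker_domRestrict] at h
  rw [← h, ← Submodule.map_comap_subtype,
    ← (Submodule.equivMapOfInjective W.subtype W.injective_subtype _).finrank_eq]

instance finiteDimensional_stdGrading (m : ℕ) : FiniteDimensional k (stdGrading k n m) :=
  Module.Finite.iff_fg.mpr (MvPolynomial.homogeneousSubmodule_fg _ _ m)

/-- The Hilbert function of `S / I` is the codimension of `I ∩ Sₘ` in `Sₘ`. -/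
theorem hilbertFunction_add_finrank_inf (I : Ideal (MvPolynomial (Fin (n + 1)) k)) (m : ℕ) :
    hilbertFunction I m +
      Module.finrank k (stdGrading k n m ⊓ I.restrictScalars k : Submodule k _) =
      Module.finrank k (stdGrading k n m) := by
  rw [← Submodule.finrank_map_add_finrank_inf_ker (Ideal.Quotient.mkₐ k I).toLinearMap
    (stdGrading k n m), hilbertFunction]
  have : LinearMap.ker (Ideal.Quotient.mkₐ k I).toLinearMap = I.restrictScalars k := by
    ext x
    exact Ideal.Quotient.eq_zero_iff_mem
  rw [this]

theorem hilbertFunction_anti {I J : Ideal (MvPolynomial (Fin (n + 1)) k)} (h : I ≤ J) (m : ℕ) :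
    hilbertFunction J m ≤ hilbertFunction I m := by
  have hI := hilbertFunction_add_finrank_inf I m
  have hJ := hilbertFunction_add_finrank_inf J m
  have : FiniteDimensional k (stdGrading k n m ⊓ J.restrictScalars k : Submodule k _) :=
    Submodule.finiteDimensional_inf_left _ _
  have := Submodule.finrank_mono (R := k) (inf_le_inf_left (stdGrading k n m)
    (show I.restrictScalars k ≤ J.restrictScalars k from h))
  omega

theorem hilbertFunction_eq_zero {I : Ideal (MvPolynomial (Fin (n + 1)) k)} {m : ℕ}
    (h : ∀ p : MvPolynomial (Fin (n + 1)) k, p.IsHomogeneous m → p ∈ I) :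
    hilbertFunction I m = 0 := by
  have hI := hilbertFunction_add_finrank_inf I m
  rw [inf_eq_left.mpr (show stdGrading k n m ≤ I.restrictScalars k from h)] at hI
  omega

/-- The ideal quotient `I : ℓ`, the preimage of `I` under multiplication by `ℓ`. -/
def Ideal.quotientBy {R : Type*} [CommRing R] (I : Ideal R) (ℓ : R) : Ideal R :=
  Submodule.comap (LinearMap.mulRight R ℓ) I

theorem Ideal.mem_quotientBy {R : Type*} [CommRing R] {I : Ideal R} {ℓ x : R} :
    x ∈ I.quotientBy ℓ ↔ x * ℓ ∈ I := Iff.rfl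

theorem Ideal.le_quotientBy {R : Type*} [CommRing R] (I : Ideal R) (ℓ : R) :
    I ≤ I.quotientBy ℓ := fun _ hx => I.mul_mem_right ℓ hx

theorem isHomogeneous_of_homogeneousComponent_mem {I : Ideal (MvPolynomial (Fin (n + 1)) k)}
    (h : ∀ p ∈ I, ∀ m, MvPolynomial.homogeneousComponent m p ∈ I) :
    I.IsHomogeneous (stdGrading k n) := by
  intro i p hp
  have := h p hp i
  rwa [← MvPolynomial.decomposition.decompose'_apply] at this

theorem Ideal.IsHomogeneous.homogeneousComponent_mem {I : Ideal (MvPolynomial (Fin (n + 1)) k)}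
    (hI : I.IsHomogeneous (stdGrading k n)) {p : MvPolynomial (Fin (n + 1)) k} (hp : p ∈ I)
    (m : ℕ) : MvPolynomial.homogeneousComponent m p ∈ I :=
  MvPolynomial.homogeneousComponent_mem_of_mem hI hp m

theorem Ideal.IsHomogeneous.quotientBy {I : Ideal (MvPolynomial (Fin (n + 1)) k)}
    (hI : I.IsHomogeneous (stdGrading k n)) {ℓ : MvPolynomial (Fin (n + 1)) k} {d : ℕ}
    (hℓ : ℓ.IsHomogeneous d) : (I.quotientBy ℓ).IsHomogeneous (stdGrading k n) := by
  refine isHomogeneous_of_homogeneousComponent_mem fun p hp m => ?_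
  rw [Ideal.mem_quotientBy, ← MvPolynomial.homogeneousComponent_mul_of_isHomogeneous hℓ]
  exact hI.homogeneousComponent_mem hp _

theorem Ideal.isHomogeneous_span_of_forall {s : Set (MvPolynomial (Fin (n + 1)) k)}
    (h : ∀ p ∈ s, ∃ d, p.IsHomogeneous d) : (Ideal.span s).IsHomogeneous (stdGrading k n) :=
  Ideal.homogeneous_span _ _ h

/-- For a linear form `ℓ`, multiplication by `ℓ` gives the exact sequence
`0 → S / (I : ℓ) (-1) → S / I → S / (I + ℓ) → 0`. -/
theorem hilbertFunction_succ {I : Ideal (MvPolynomial (Fin (n + 1)) k)}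
    (hI : I.IsHomogeneous (stdGrading k n)) {ℓ : MvPolynomial (Fin (n + 1)) k}
    (hℓ : ℓ.IsHomogeneous 1) (m : ℕ) :
    hilbertFunction I (m + 1) =
      hilbertFunction (I.quotientBy ℓ) m + hilbertFunction (I ⊔ Ideal.span {ℓ}) (m + 1) := by
  set π := (Ideal.Quotient.mkₐ k I).toLinearMap
  set J := I ⊔ Ideal.span {ℓ}
  have hπ (x) : π x = 0 ↔ x ∈ I := Ideal.Quotient.eq_zero_iff_mem
  have hker : LinearMap.ker π = I.restrictScalars k := by ext x; exact hπ x
  have key : (stdGrading k n (m + 1) ⊓ J.restrictScalars k).map π =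
      (stdGrading k n m).map (π ∘ₗ LinearMap.mulRight k ℓ) := by
    ext y
    constructor
    · rintro ⟨g, ⟨hg, hgJ⟩, rfl⟩
      obtain ⟨a, ha, c, hc, rfl⟩ := Submodule.mem_sup.mp hgJ
      obtain ⟨b, rfl⟩ := Ideal.mem_span_singleton'.mp hc
      refine ⟨MvPolynomial.homogeneousComponent m b,
        MvPolynomial.homogeneousComponent_mem _ _, ?_⟩
      have h1 := MvPolynomial.homogeneousComponent_eq_self hg
      rw [map_add, MvPolynomial.homogeneousComponent_mul_of_isHomogeneous hℓ] at h1
      rw [← h1, map_add, (hπ _).mpr (hI.homogeneousComponent_mem ha _), zero_add]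
      rfl
    · rintro ⟨b, hb, rfl⟩
      exact ⟨b * ℓ, ⟨MvPolynomial.IsHomogeneous.mul hb hℓ, Ideal.mem_sup_right
        (Ideal.mul_mem_left _ _ (Ideal.mem_span_singleton_self ℓ))⟩, rfl⟩
  have : FiniteDimensional k (stdGrading k n (m + 1) ⊓ J.restrictScalars k : Submodule k _) :=
    Submodule.finiteDimensional_inf_left _ _
  have e1 := Submodule.finrank_map_add_finrank_inf_ker π
    (stdGrading k n (m + 1) ⊓ J.restrictScalars k)
  have e2 := Submodule.finrank_map_add_finrank_inf_ker (π ∘ₗ LinearMap.mulRight k ℓ)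
    (stdGrading k n m)
  have k1 : stdGrading k n (m + 1) ⊓ J.restrictScalars k ⊓ LinearMap.ker π =
      stdGrading k n (m + 1) ⊓ I.restrictScalars k := by
    rw [hker, inf_assoc, inf_eq_right.mpr (show I.restrictScalars k ≤ J.restrictScalars k from
      fun x hx => Ideal.mem_sup_left hx)]
  have k2 : LinearMap.ker (π ∘ₗ LinearMap.mulRight k ℓ) = (I.quotientBy ℓ).restrictScalars k := by
    ext x; exact hπ _
  rw [key, k1] at e1
  rw [k2] at e2
  have f1 := hilbertFunction_add_finrank_inf I (m + 1)
  have f2 := hilbertFunction_add_finrank_inf J (m + 1)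
  have f3 := hilbertFunction_add_finrank_inf (I.quotientBy ℓ) m
  omega

/-! ### Existence of the Hilbert polynomial -/

theorem Polynomial.exists_eval_add_one_sub_eval (Q : Polynomial ℚ) :
    ∃ R : Polynomial ℚ, ∀ x, R.eval (x + 1) - R.eval x = Q.eval x := by
  induction Q using Polynomial.induction_on' with
  | add p q hp hq =>
    obtain ⟨P, hP⟩ := hp
    obtain ⟨Q, hQ⟩ := hq
    refine ⟨P + Q, fun x => ?_⟩
    rw [eval_add, eval_add, eval_add, ← hP, ← hQ]
    ring
  | monomial m a =>
    refine ⟨C (a / (m + 1)) * Polynomial.bernoulli (m + 1), fun x => ?_⟩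
    have h0 : (m : ℚ) + 1 ≠ 0 := by positivity
    have h1 : a / (m + 1) * (m + 1) = a := div_mul_cancel₀ a h0
    rw [eval_mul, eval_mul, add_comm x 1, Polynomial.bernoulli_eval_one_add, eval_C, eval_C,
      eval_monomial]
    push_cast
    linear_combination x ^ m * h1

theorem exists_polynomial_of_eventually_difference {h : ℕ → ℕ} {Q : Polynomial ℚ}
    (hQ : ∀ᶠ m : ℕ in Filter.atTop, (h (m + 1) : ℚ) = h m + Q.eval (m : ℚ)) :
    ∃ P : Polynomial ℚ, ∀ᶠ m : ℕ in Filter.atTop, P.eval (m : ℚ) = h m := by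
  obtain ⟨R, hR⟩ := Q.exists_eval_add_one_sub_eval
  obtain ⟨N, hN⟩ := Filter.eventually_atTop.mp hQ
  refine ⟨R + Polynomial.C (h N - R.eval (N : ℚ)), Filter.eventually_atTop.mpr ⟨N, fun m hm => ?_⟩⟩
  induction m, hm using Nat.le_induction with
  | base => simp
  | succ m hm ih =>
    rw [hN m hm, ← ih, ← hR]
    push_cast
    simp only [Polynomial.eval_add, Polynomial.eval_C]
    ring

/-- Existence of the Hilbert polynomial. By Noetherian induction it may be assumed for all larger
homogeneous ideals; if some variable `x` is not in `I`, this applies to `I + x`, and to `I : x`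
unless `I : x = I`, in which case the Hilbert function of `S / I` has polynomial differences. -/
theorem exists_isHilbertPolynomial (I : Ideal (MvPolynomial (Fin (n + 1)) k))
    (hI : I.IsHomogeneous (stdGrading k n)) : ∃ P, IsHilbertPolynomial I P := by
  induction I using WellFoundedGT.induction with
  | ind I ih =>
  by_cases hx : ∃ i, (MvPolynomial.X i : MvPolynomial (Fin (n + 1)) k) ∉ I
  · obtain ⟨i, hi⟩ := hx
    have hℓ := MvPolynomial.isHomogeneous_X k i
    set ℓ : MvPolynomial (Fin (n + 1)) k := MvPolynomial.X i
    have hℓI : Ideal.span {ℓ} ≤ I ⊔ Ideal.span {ℓ} := le_sup_right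
    obtain ⟨Q, hQ⟩ := ih (I ⊔ Ideal.span {ℓ})
      (lt_of_le_of_ne le_sup_left fun h => hi (h ▸ hℓI (Ideal.mem_span_singleton_self ℓ)))
      (hI.sup (Ideal.isHomogeneous_span_of_forall (by simpa using ⟨1, hℓ⟩)))
    by_cases hc : I.quotientBy ℓ = I
    · refine exists_polynomial_of_eventually_difference (Q := Q.comp (Polynomial.X + 1)) ?_
      filter_upwards [(Filter.tendsto_add_atTop_nat 1).eventually hQ] with m hm
      rw [hilbertFunction_succ hI hℓ, hc]
      push_cast at hm ⊢
      simp [hm]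
    · obtain ⟨P, hP⟩ := ih (I.quotientBy ℓ) (lt_of_le_of_ne (I.le_quotientBy ℓ) (Ne.symm hc))
        (hI.quotientBy hℓ)
      refine ⟨P.comp (Polynomial.X - 1) + Q, ?_⟩
      rw [IsHilbertPolynomial] at hP hQ ⊢
      rw [← Filter.map_add_atTop_eq_nat 1, Filter.eventually_map] at hQ ⊢
      filter_upwards [hP, hQ] with m h1 h2
      rw [hilbertFunction_succ hI hℓ, Polynomial.eval_add, h2, Polynomial.eval_comp]
      simp [h1]
  · push Not at hx
    refine ⟨0, Filter.eventually_atTop.mpr ⟨1, fun m hm => ?_⟩⟩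
    rw [hilbertFunction_eq_zero, Polynomial.eval_zero, Nat.cast_zero]
    exact fun p hp => MvPolynomial.mem_of_forall_X_mem hx (hp.coeff_zero_eq_zero hm)

theorem isHilbertPolynomial_hilbertPolynomial {I : Ideal (MvPolynomial (Fin (n + 1)) k)}
    (hI : I.IsHomogeneous (stdGrading k n)) : IsHilbertPolynomial I (hilbertPolynomial I) := by
  have h := exists_isHilbertPolynomial I hI
  rw [hilbertPolynomial, dif_pos h]
  exact h.choose_spec

/-! ### Upper bounds for the Hilbert function -/

theorem hilbertFunction_succ_le {I : Ideal (MvPolynomial (Fin (n + 1)) k)}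
    (hI : I.IsHomogeneous (stdGrading k n)) {ℓ : MvPolynomial (Fin (n + 1)) k}
    (hℓ : ℓ.IsHomogeneous 1) (m : ℕ) :
    hilbertFunction I (m + 1) ≤
      hilbertFunction I m + hilbertFunction (I ⊔ Ideal.span {ℓ}) (m + 1) := by
  rw [hilbertFunction_succ hI hℓ]
  gcongr
  exact hilbertFunction_anti (I.le_quotientBy ℓ) m

/-- Growth of the Hilbert function on adding one dimension: if the summatory Hilbert function of a
hyperplane section is `O(mᵈ)`, then so is the Hilbert function itself. -/
theorem hilbertFunction_le_of_sum_le {I : Ideal (MvPolynomial (Fin (n + 1)) k)}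
    (hI : I.IsHomogeneous (stdGrading k n)) {ℓ : MvPolynomial (Fin (n + 1)) k}
    (hℓ : ℓ.IsHomogeneous 1) {d C : ℕ}
    (h : ∀ m, ∑ i ∈ Finset.range m, hilbertFunction (I ⊔ Ideal.span {ℓ}) i ≤ C * (m + 1) ^ d) :
    ∃ C', ∀ m, hilbertFunction I m ≤ C' * (m + 1) ^ d := by
  refine ⟨hilbertFunction I 0 + C * 2 ^ d, fun m => ?_⟩
  have h1 : hilbertFunction I m ≤ hilbertFunction I 0 +
      ∑ i ∈ Finset.range (m + 1), hilbertFunction (I ⊔ Ideal.span {ℓ}) i := by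
    induction m with
    | zero => simp
    | succ m ih =>
      rw [Finset.sum_range_succ]
      have := hilbertFunction_succ_le hI hℓ m
      omega
  calc hilbertFunction I m ≤ hilbertFunction I 0 + C * (m + 1 + 1) ^ d := by
        have := h (m + 1)
        omega
    _ ≤ hilbertFunction I 0 * (m + 1) ^ d + C * (2 * (m + 1)) ^ d := by
        gcongr
        · exact Nat.le_mul_of_pos_right _ (by positivity)
        · omega
    _ = _ := by rw [mul_pow]; ring

theorem Ideal.sup_span_range_eq {R : Type*} [CommRing R] {s : ℕ} (I : Ideal R)
    (y : Fin (s + 1) → R) :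
    I ⊔ Ideal.span (Set.range y) =
      I ⊔ Ideal.span {y 0} ⊔ Ideal.span (Set.range (Fin.tail y)) := by
  rw [sup_assoc, ← Ideal.span_union, Set.singleton_union]
  congr 2
  conv_lhs => rw [← Fin.cons_self_tail y, Fin.range_cons]

/-- If `s` linear forms cut `S / I` down to finite length, then the summatory Hilbert function of
`S / I` is `O(mˢ)`. -/
theorem sum_hilbertFunction_le {s : ℕ} {I : Ideal (MvPolynomial (Fin (n + 1)) k)}
    (hI : I.IsHomogeneous (stdGrading k n)) {y : Fin s → MvPolynomial (Fin (n + 1)) k}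
    (hy : ∀ j, (y j).IsHomogeneous 1)
    (h : ∀ᶠ m in Filter.atTop, hilbertFunction (I ⊔ Ideal.span (Set.range y)) m = 0) :
    ∃ C, ∀ m, ∑ i ∈ Finset.range m, hilbertFunction I i ≤ C * (m + 1) ^ s := by
  induction s generalizing I with
  | zero =>
    obtain ⟨N, hN⟩ := Filter.eventually_atTop.mp h
    refine ⟨∑ i ∈ Finset.range N, hilbertFunction I i, fun m => ?_⟩
    rw [pow_zero, mul_one]
    have hz (i : ℕ) (hi : N ≤ i) : hilbertFunction I i = 0 := by
      simpa using hN i hi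
    rcases le_total m N with hm | hm
    · exact Finset.sum_le_sum_of_subset (Finset.range_mono hm)
    · exact (Finset.sum_subset (Finset.range_mono hm) fun i _ hi =>
        hz i (by simpa using hi)).ge
  | succ s ih =>
    obtain ⟨C, hC⟩ := ih (I := I ⊔ Ideal.span {y 0})
      (hI.sup (Ideal.isHomogeneous_span_of_forall (by simpa using ⟨1, hy 0⟩)))
      (y := Fin.tail y) (fun j => hy j.succ) (Ideal.sup_span_range_eq I y ▸ h)
    obtain ⟨C', hC'⟩ := hilbertFunction_le_of_sum_le hI (hy 0) hC
    refine ⟨C', fun m => ?_⟩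
    calc _ ≤ ∑ i ∈ Finset.range m, C' * (m + 1) ^ s := by
          refine Finset.sum_le_sum fun i hi => (hC' i).trans ?_
          have := Finset.mem_range.mp hi
          gcongr
      _ = m * (C' * (m + 1) ^ s) := by simp
      _ ≤ (m + 1) * (C' * (m + 1) ^ s) := by gcongr; omega
      _ = _ := by ring

/-- If `d + 1` linear forms cut `S / I` down to finite length, then the Hilbert function of `S / I`
is `O(mᵈ)`. -/
theorem hilbertFunction_le {d : ℕ} {I : Ideal (MvPolynomial (Fin (n + 1)) k)}
    (hI : I.IsHomogeneous (stdGrading k n)) {y : Fin (d + 1) → MvPolynomial (Fin (n + 1)) k}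
    (hy : ∀ j, (y j).IsHomogeneous 1)
    (h : ∀ᶠ m in Filter.atTop, hilbertFunction (I ⊔ Ideal.span (Set.range y)) m = 0) :
    ∃ C, ∀ m, hilbertFunction I m ≤ C * (m + 1) ^ d := by
  obtain ⟨C, hC⟩ := sum_hilbertFunction_le (I := I ⊔ Ideal.span {y 0})
    (hI.sup (Ideal.isHomogeneous_span_of_forall (by simpa using ⟨1, hy 0⟩)))
    (y := Fin.tail y) (fun j => hy j.succ) (Ideal.sup_span_range_eq I y ▸ h)
  exact hilbertFunction_le_of_sum_le hI (hy 0) hC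

/-! ### Lower bounds for the Hilbert function and the degree -/

theorem MvPolynomial.choose_le_finrank_homogeneousSubmodule (d m : ℕ) :
    (m + d).choose d ≤ Module.finrank k (homogeneousSubmodule (Fin (d + 1)) k m) := by
  let T := (Finset.univ : Finset (Fin (d + 1))).finsuppAntidiag m
  let b : T → homogeneousSubmodule (Fin (d + 1)) k m := fun t =>
    ⟨monomial t.1 1, isHomogeneous_monomial 1 (by
      have := (Finset.mem_finsuppAntidiag.mp t.2).1
      rwa [Finsupp.degree_eq_sum])⟩
  have hb : LinearIndependent k b := by
    refine LinearIndependent.of_comp (homogeneousSubmodule (Fin (d + 1)) k m).subtype ?_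
    have := (basisMonomials (Fin (d + 1)) k).linearIndependent.comp (Subtype.val : T → _)
      Subtype.val_injective
    have e : ⇑(homogeneousSubmodule (Fin (d + 1)) k m).subtype ∘ b =
        ⇑(basisMonomials (Fin (d + 1)) k) ∘ (Subtype.val : T → _) := by
      ext1 t
      simp [b]
    exact e ▸ this
  have : FiniteDimensional k (homogeneousSubmodule (Fin (d + 1)) k m) :=
    Module.Finite.iff_fg.mpr (homogeneousSubmodule_fg _ _ m)
  have h := hb.fintype_card_le_finrank
  rw [Fintype.card_coe, Finset.card_finsuppAntidiag_nat_eq_choose, Finset.card_univ,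
    Fintype.card_fin, show d + 1 + m - 1 = m + d by omega] at h
  rwa [← Nat.choose_symm_add]

open MvPolynomial in
/-- If `1, z, …, z ^ (e - 1)` are linearly independent over `k[y₀, …, y_d]` modulo `I`, then
`⊕_{i < e} k[y₀, …, y_d]_{m - i} zⁱ` embeds into `(S / I)ₘ`. -/
theorem mul_choose_le_hilbertFunction {d e : ℕ} {I : Ideal (MvPolynomial (Fin (n + 1)) k)}
    {y : Fin (d + 1) → MvPolynomial (Fin (n + 1)) k} (hy : ∀ j, (y j).IsHomogeneous 1)
    {z : MvPolynomial (Fin (n + 1)) k} (hz : z.IsHomogeneous 1)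
    (hI : ∀ G : Polynomial (MvPolynomial (Fin (d + 1)) k), G ≠ 0 →
      G.eval₂ (aeval y : _ →ₐ[k] MvPolynomial (Fin (n + 1)) k).toRingHom z ∈ I → e ≤ G.natDegree)
    {m : ℕ} (hm : e ≤ m) :
    e * (m - (e - 1) + d).choose d ≤ hilbertFunction I m := by
  let A (j : ℕ) := homogeneousSubmodule (Fin (d + 1)) k j
  have (j : ℕ) : FiniteDimensional k (A j) :=
    Module.Finite.iff_fg.mpr (homogeneousSubmodule_fg _ _ j)
  let V := (stdGrading k n m).map (Ideal.Quotient.mkₐ k I).toLinearMap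
  let φ : ((i : Fin e) → A (m - i)) →ₗ[k] MvPolynomial (Fin (n + 1)) k :=
    ∑ i : Fin e, (LinearMap.mulRight k (z ^ (i : ℕ))) ∘ₗ (aeval y).toLinearMap ∘ₗ
      (A (m - i)).subtype ∘ₗ LinearMap.proj i
  have hφ (a) : φ a = ∑ i : Fin e, aeval y (a i).1 * z ^ (i : ℕ) := by
    simp [φ, LinearMap.sum_apply]
  have hφm (a) : (φ a).IsHomogeneous m := by
    rw [hφ]
    refine IsHomogeneous.sum _ _ _ fun i _ => ?_
    have h1 := (IsHomogeneous.aeval (a i).2 y hy).mul (hz.pow (i : ℕ))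
    convert h1 using 1
    omega
  let ψ : ((i : Fin e) → A (m - i)) →ₗ[k] V :=
    ((Ideal.Quotient.mkₐ k I).toLinearMap ∘ₗ φ).codRestrict V
      fun a => Submodule.mem_map_of_mem (hφm a)
  have hψ : Function.Injective ψ := by
    rw [← LinearMap.ker_eq_bot, LinearMap.ker_eq_bot']
    intro a ha
    have ha' : φ a ∈ I := Ideal.Quotient.eq_zero_iff_mem.mp (congrArg Subtype.val ha)
    let G : Polynomial (MvPolynomial (Fin (d + 1)) k) :=
      ∑ i : Fin e, Polynomial.C (a i).1 * Polynomial.X ^ (i : ℕ)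
    have hG0 : G = 0 := by
      by_contra hG
      have h1 := hI G hG (by
        rw [hφ] at ha'
        simpa [G, Polynomial.eval₂_finsetSum] using ha')
      have h2 : G.degree < e := Polynomial.degree_sum_fin_lt fun i => (a i).1
      rw [Polynomial.degree_eq_natDegree hG] at h2
      norm_cast at h2
      omega
    ext1 i
    have h3 : G.coeff i = (a i).1 := by
      simp only [G, Polynomial.finsetSum_coeff, Polynomial.coeff_C_mul_X_pow]
      rw [Finset.sum_eq_single i]
      · simp
      · intro j _ hj
        rw [if_neg (fun h => hj (Fin.ext h.symm))]
      · simp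
    rw [hG0] at h3
    exact Subtype.ext h3.symm
  have hV : FiniteDimensional k V := inferInstance
  have h := LinearMap.finrank_le_finrank_of_injective hψ
  rw [Module.finrank_pi_fintype] at h
  refine le_trans ?_ h
  calc e * (m - (e - 1) + d).choose d = ∑ _i : Fin e, (m - (e - 1) + d).choose d := by simp
    _ ≤ _ := Finset.sum_le_sum fun i _ =>
      (Nat.choose_le_choose d (by omega)).trans (choose_le_finrank_homogeneousSubmodule d _)

namespace Polynomial

theorem leadingCoeff_nonneg_of_eventually {P : Polynomial ℚ}
    (h : ∀ᶠ m : ℕ in Filter.atTop, 0 ≤ P.eval (m : ℚ)) : 0 ≤ P.leadingCoeff := by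
  by_contra! hneg
  rcases Nat.eq_zero_or_pos P.natDegree with h0 | h0
  · obtain ⟨m, hm⟩ := h.exists
    rw [eq_C_of_natDegree_eq_zero h0, eval_C, ← h0] at hm
    exact absurd hneg (not_lt.mpr hm)
  · have := (P.tendsto_atBot_of_leadingCoeff_nonpos (natDegree_pos_iff_degree_pos.mp h0)
      hneg.le).comp tendsto_natCast_atTop_atTop
    obtain ⟨m, h1, h2⟩ := (h.and (this.eventually (Filter.eventually_lt_atBot 0))).exists
    exact absurd h1 (not_le.mpr h2)

/-- A polynomial squeezed between a polynomial of degree `d` with positive leading coefficient and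
one of degree at most `d` has degree `d`, and the lower bound bounds its leading coefficient. -/
theorem natDegree_eq_and_le_leadingCoeff {P Q R : Polynomial ℚ} {d : ℕ} (hQ : Q.natDegree = d)
    (hQ0 : 0 < Q.leadingCoeff) (hR : R.natDegree ≤ d)
    (hQP : ∀ᶠ m : ℕ in Filter.atTop, Q.eval (m : ℚ) ≤ P.eval (m : ℚ))
    (hPR : ∀ᶠ m : ℕ in Filter.atTop, P.eval (m : ℚ) ≤ R.eval (m : ℚ)) :
    P.natDegree = d ∧ Q.leadingCoeff ≤ P.leadingCoeff := by
  have h1 : 0 ≤ (P - Q).leadingCoeff :=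
    leadingCoeff_nonneg_of_eventually (by simpa using hQP)
  have h2 : 0 ≤ (R - P).leadingCoeff :=
    leadingCoeff_nonneg_of_eventually (by simpa using hPR)
  have hle : P.natDegree ≤ d := by
    by_contra! hlt
    have hP0 : P ≠ 0 := by
      rintro rfl
      simp at hlt
    rw [leadingCoeff_sub_of_degree_lt' (degree_lt_degree (by omega))] at h2
    rw [leadingCoeff_sub_of_degree_lt (degree_lt_degree (by omega))] at h1
    exact hP0 (leadingCoeff_eq_zero.mp (le_antisymm (by linarith) h1))
  have hco : Q.coeff d ≤ P.coeff d := by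
    have hd : (P - Q).natDegree ≤ d := (natDegree_sub_le _ _).trans (by simp [hle, hQ])
    rcases hd.lt_or_eq with hlt | heq
    · have := coeff_eq_zero_of_natDegree_lt hlt
      rw [coeff_sub] at this
      linarith
    · rw [leadingCoeff, heq, coeff_sub] at h1
      linarith
  have hQd : Q.leadingCoeff = Q.coeff d := by rw [leadingCoeff, hQ]
  have heq : P.natDegree = d :=
    natDegree_eq_of_le_of_coeff_ne_zero hle (by rw [hQd] at hQ0; exact (hQ0.trans_le hco).ne')
  refine ⟨heq, ?_⟩
  rw [hQd, leadingCoeff, heq]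
  exact hco

end Polynomial

open MvPolynomial in
/-- The degree read off the Hilbert polynomial bounds from above the degree over `k[y₀, …, y_d]` of
every linear form, if `y₀, …, y_d` is a homogeneous system of parameters of `S / I`. -/
theorem le_factorial_mul_leadingCoeff_hilbertPolynomial {d e : ℕ} (he : 0 < e)
    {I : Ideal (MvPolynomial (Fin (n + 1)) k)} (hhom : I.IsHomogeneous (stdGrading k n))
    {y : Fin (d + 1) → MvPolynomial (Fin (n + 1)) k} (hy : ∀ j, (y j).IsHomogeneous 1)
    (hyI : ∀ᶠ m in Filter.atTop, hilbertFunction (I ⊔ Ideal.span (Set.range y)) m = 0)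
    {z : MvPolynomial (Fin (n + 1)) k} (hz : z.IsHomogeneous 1)
    (hI : ∀ G : Polynomial (MvPolynomial (Fin (d + 1)) k), G ≠ 0 →
      G.eval₂ (aeval y : _ →ₐ[k] MvPolynomial (Fin (n + 1)) k).toRingHom z ∈ I → e ≤ G.natDegree) :
    (e : ℚ) ≤ ((hilbertPolynomial I).natDegree.factorial : ℚ) *
      (hilbertPolynomial I).leadingCoeff := by
  have hH := isHilbertPolynomial_hilbertPolynomial hhom
  set P := hilbertPolynomial I
  obtain ⟨C, hC⟩ := hilbertFunction_le hhom hy hyI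
  have he0 : (e : ℚ) ≠ 0 := by positivity
  set Q : Polynomial ℚ := Polynomial.C (e : ℚ) * Polynomial.preHilbertPoly ℚ d (e - 1)
  have hQl : Q.leadingCoeff = e * (d.factorial : ℚ)⁻¹ := by
    rw [Polynomial.leadingCoeff_mul, Polynomial.leadingCoeff_C,
      Polynomial.leadingCoeff_preHilbertPoly]
  obtain ⟨h1, h2⟩ := Polynomial.natDegree_eq_and_le_leadingCoeff (P := P) (d := d) (Q := Q)
    (R := Polynomial.C (C : ℚ) * (Polynomial.X + Polynomial.C 1) ^ d)
    (by rw [Polynomial.natDegree_C_mul he0, Polynomial.natDegree_preHilbertPoly])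
    (by rw [hQl]; positivity)
    ((Polynomial.natDegree_C_mul_le _ _).trans (Polynomial.natDegree_pow_le.trans
      (by rw [Polynomial.natDegree_X_add_C, mul_one])))
    (by
      filter_upwards [hH, Filter.eventually_ge_atTop e] with m h3 h4
      rw [h3, Polynomial.eval_mul, Polynomial.eval_C,
        Polynomial.preHilbertPoly_eq_choose_sub_add ℚ d (by omega)]
      exact_mod_cast mul_choose_le_hilbertFunction hy hz hI h4)
    (by
      filter_upwards [hH] with m h3
      rw [h3]
      simpa using (by exact_mod_cast hC m : (hilbertFunction I m : ℚ) ≤ C * (m + 1) ^ d))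
  rw [h1]
  rw [hQl] at h2
  calc (e : ℚ) = d.factorial * (e * (d.factorial : ℚ)⁻¹) := by field_simp
    _ ≤ _ := by gcongr

/-! ### Graded Noether normalization by linear forms -/

/-- Transitivity of integrality in the form: if `B` is integral over `R'`, and the image of `R'` in
`B` is integral over `R`, then `B` is integral over `R`. -/
theorem RingHom.IsIntegral.of_forall_isIntegralElem {R R' B : Type*} [CommRing R]
    [CommRing R'] [CommRing B]
    {f : R →+* B} {g : R' →+* B} (hg : g.IsIntegral) (h : ∀ x, f.IsIntegralElem (g x)) :
    f.IsIntegral := by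
  algebraize [f]
  let ψ : R' →+* integralClosure R B := g.codRestrict (integralClosure R B) h
  have h1 : (algebraMap (integralClosure R B) B).IsIntegral :=
    RingHom.IsIntegral.tower_top ψ _ (show ((algebraMap (integralClosure R B) B).comp ψ).IsIntegral
      from hg)
  intro b
  have : Algebra.IsIntegral (integralClosure R B) B := ⟨h1⟩
  exact isIntegral_trans (R := R) (A := integralClosure R B) b (h1 b)

theorem RingHom.IsIntegral.of_forall_X {R σ K B : Type*} [CommRing R] [CommRing K] [CommRing B]
    {f : R →+* B} {g : MvPolynomial σ K →+* B} (hg : g.IsIntegral)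
    (hC : ∀ a, f.IsIntegralElem (g (MvPolynomial.C a)))
    (hX : ∀ i, f.IsIntegralElem (g (MvPolynomial.X i))) : f.IsIntegral := by
  refine hg.of_forall_isIntegralElem fun p => ?_
  induction p using MvPolynomial.induction_on with
  | C a => exact hC a
  | add p q hp hq => rw [map_add]; exact hp.add f hq
  | mul_X p i hp => rw [map_mul]; exact hp.mul f (hX i)

namespace Polynomial

variable {R : Type*} [CommRing R] {ι : Type*}

theorem natDegree_prod_linear_pow_le_and_coeff (a b : ι → R) (d : ι → ℕ) (s : Finset ι) :
    (∏ i ∈ s, (C (a i) + C (b i) * X) ^ d i).natDegree ≤ ∑ i ∈ s, d i ∧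
      (∏ i ∈ s, (C (a i) + C (b i) * X) ^ d i).coeff (∑ i ∈ s, d i) = ∏ i ∈ s, b i ^ d i := by
  classical
  have h1 (i : ι) : (C (a i) + C (b i) * X).natDegree ≤ 1 := by
    rw [add_comm]; exact natDegree_linear_le
  have h2 (i : ι) : ((C (a i) + C (b i) * X) ^ d i).natDegree ≤ d i := by
    simpa using natDegree_pow_le_of_le (d i) (h1 i)
  have h3 (i : ι) : ((C (a i) + C (b i) * X) ^ d i).coeff (d i) = b i ^ d i := by
    simpa [coeff_C] using coeff_pow_of_natDegree_le (m := d i) (h1 i)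
  induction s using Finset.induction_on with
  | empty => simp
  | insert i s hi ih =>
    rw [Finset.prod_insert hi, Finset.sum_insert hi, Finset.prod_insert hi]
    exact ⟨natDegree_mul_le_of_le (h2 i) ih.1,
      by rw [coeff_mul_add_eq_of_natDegree_le (h2 i) ih.1, h3, ih.2]⟩

/-- Substituting `aᵢ + bᵢ T` into a form `F` of degree `m` gives a polynomial in `T` of degree at
most `m`, with `T ^ m` having coefficient `F(b)`. -/
theorem natDegree_aeval_linear_le_and_coeff {K : Type*} [CommRing K] [Algebra K R]
    {F : MvPolynomial ι K} {m : ℕ} (hF : F.IsHomogeneous m) (a b : ι → R) :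
    (MvPolynomial.aeval (fun i => C (a i) + C (b i) * X) F).natDegree ≤ m ∧
      (MvPolynomial.aeval (fun i => C (a i) + C (b i) * X) F).coeff m =
        MvPolynomial.aeval b F := by
  have hd : ∀ d ∈ F.support, ∑ i ∈ d.support, d i = m :=
    fun d hd => (hF.degree_eq_sum_deg_support hd).symm
  rw [F.as_sum, map_sum, map_sum]
  simp only [MvPolynomial.aeval_monomial, Finsupp.prod, Polynomial.algebraMap_apply]
  refine ⟨natDegree_sum_le_of_forall_le _ _ fun d hdF => ?_, ?_⟩
  · refine (natDegree_C_mul_le _ _).trans ?_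
    rw [← hd d hdF]
    exact (natDegree_prod_linear_pow_le_and_coeff a b d d.support).1
  · rw [finsetSum_coeff]
    refine Finset.sum_congr rfl fun d hdF => ?_
    rw [coeff_C_mul, ← hd d hdF, (natDegree_prod_linear_pow_le_and_coeff a b d d.support).2]

end Polynomial

/-- The homomorphism `k[Y₀, …, Y_{s-1}] → S / J` sending `Yᵢ` to the class of `yᵢ`. -/
def formsHom {s : ℕ} (y : Fin s → MvPolynomial (Fin (n + 1)) k)
    (J : Ideal (MvPolynomial (Fin (n + 1)) k)) :
    MvPolynomial (Fin s) k →+* MvPolynomial (Fin (n + 1)) k ⧸ J :=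
  (Ideal.Quotient.mk J).comp (MvPolynomial.aeval y : _ →ₐ[k] MvPolynomial (Fin (n + 1)) k).toRingHom

section FormsHom

variable {s : ℕ} {y : Fin s → MvPolynomial (Fin (n + 1)) k}
  {J : Ideal (MvPolynomial (Fin (n + 1)) k)}

theorem formsHom_apply (F : MvPolynomial (Fin s) k) :
    formsHom y J F = Ideal.Quotient.mk J (MvPolynomial.aeval y F) := rfl

theorem formsHom_eq_zero_iff {F : MvPolynomial (Fin s) k} :
    formsHom y J F = 0 ↔ MvPolynomial.aeval y F ∈ J := Ideal.Quotient.eq_zero_iff_mem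

theorem eval₂_formsHom_mk (G : Polynomial (MvPolynomial (Fin s) k))
    (z : MvPolynomial (Fin (n + 1)) k) :
    G.eval₂ (formsHom y J) (Ideal.Quotient.mk J z) = Ideal.Quotient.mk J
      (G.eval₂ (MvPolynomial.aeval y : _ →ₐ[k] MvPolynomial (Fin (n + 1)) k).toRingHom z) := by
  rw [Polynomial.hom_eval₂]
  rfl

theorem formsHom_isIntegralElem_C (a : k) :
    (formsHom y J).IsIntegralElem (Ideal.Quotient.mk J (MvPolynomial.C a)) := by
  have : Ideal.Quotient.mk J (MvPolynomial.C a) = formsHom y J (MvPolynomial.C a) := by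
    simp [formsHom_apply, MvPolynomial.algebraMap_eq]
  rw [this]
  exact RingHom.isIntegralElem_map _

theorem formsHom_isIntegralElem_self (i : Fin s) :
    (formsHom y J).IsIntegralElem (Ideal.Quotient.mk J (y i)) := by
  have : Ideal.Quotient.mk J (y i) = formsHom y J (MvPolynomial.X i) := by simp [formsHom_apply]
  rw [this]
  exact RingHom.isIntegralElem_map _

theorem formsHom_isIntegral_of_forall_X
    (h : ∀ i, (formsHom y J).IsIntegralElem (Ideal.Quotient.mk J (MvPolynomial.X i))) :
    (formsHom y J).IsIntegral :=
  RingHom.IsIntegral.of_forall_X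
    (RingHom.isIntegral_of_surjective _ Ideal.Quotient.mk_surjective)
    formsHom_isIntegralElem_C h

theorem formsHom_isIntegral_of_forall {t : ℕ} {y' : Fin t → MvPolynomial (Fin (n + 1)) k}
    (h : (formsHom y' J).IsIntegral)
    (h' : ∀ i, (formsHom y J).IsIntegralElem (Ideal.Quotient.mk J (y' i))) :
    (formsHom y J).IsIntegral := by
  refine RingHom.IsIntegral.of_forall_X h (fun a => ?_) fun i => ?_
  · rw [formsHom_apply, MvPolynomial.aeval_C, MvPolynomial.algebraMap_eq]
    exact formsHom_isIntegralElem_C a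
  · rw [formsHom_apply, MvPolynomial.aeval_X]
    exact h' i

end FormsHom

namespace MvPolynomial

theorem IsHomogeneous.eval_smul {σ R : Type*} [CommSemiring R] {F : MvPolynomial σ R} {m : ℕ}
    (hF : F.IsHomogeneous m) (r : R) (x : σ → R) : eval (r • x) F = r ^ m * eval x F := by
  rw [eval_eq, eval_eq, Finset.mul_sum]
  refine Finset.sum_congr rfl fun d hd => ?_
  rw [hF.degree_eq_sum_deg_support hd, ← Finset.prod_pow_eq_pow_sum, mul_left_comm,
    ← Finset.prod_mul_distrib]
  simp [mul_pow]

theorem homogeneousComponent_aeval {σ τ : Type*} {y : σ → MvPolynomial τ k}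
    (hy : ∀ i, (y i).IsHomogeneous 1) (F : MvPolynomial σ k) (m : ℕ) :
    homogeneousComponent m (aeval y F) = aeval y (homogeneousComponent m F) := by
  conv_lhs => rw [← sum_homogeneousComponent F]
  rw [map_sum, map_sum]
  have h (i : ℕ) : homogeneousComponent m (aeval y (homogeneousComponent i F)) =
      if m = i then aeval y (homogeneousComponent i F) else 0 := by
    rw [homogeneousComponent_of_mem (n := i)]
    simpa using (homogeneousComponent_isHomogeneous i F).aeval y hy
  simp_rw [h]
  rw [Finset.sum_ite_eq]
  split_ifs with hm
  · rfl
  · rw [homogeneousComponent_eq_zero _ _ (by simpa using hm), map_zero]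

end MvPolynomial

open MvPolynomial in
/-- If linear forms `y₀, …, y_t` satisfy a homogeneous relation modulo `J`, then one of them can be
eliminated: after a linear change of coordinates the relation is monic in it. -/
theorem exists_formsHom_isIntegral_of_relation [Infinite k] {t m : ℕ}
    {J : Ideal (MvPolynomial (Fin (n + 1)) k)} (hJ : J ≠ ⊤)
    {y : Fin (t + 1) → MvPolynomial (Fin (n + 1)) k} (hy : ∀ i, (y i).IsHomogeneous 1)
    (hint : (formsHom y J).IsIntegral) {F : MvPolynomial (Fin (t + 1)) k}
    (hF : F.IsHomogeneous m) (hF0 : F ≠ 0) (hFJ : aeval y F ∈ J) :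
    ∃ y' : Fin t → MvPolynomial (Fin (n + 1)) k, (∀ i, (y' i).IsHomogeneous 1) ∧
      (formsHom y' J).IsIntegral := by
  obtain ⟨c, hc⟩ : ∃ c : Fin (t + 1) → k, eval c F ≠ 0 := by
    by_contra! h
    exact hF0 (hF.eq_zero_of_forall_eval_eq_zero h)
  obtain ⟨j, hj⟩ : ∃ j, c j ≠ 0 := by
    by_contra! h
    have hc0 : c = 0 := funext h
    rw [hc0, eval_zero, constantCoeff_eq] at hc
    have hm : m = 0 := by
      have := hF hc
      simpa using this.symm
    rw [hm] at hF
    have h1 := totalDegree_eq_zero_iff_eq_C.mp (Nat.le_zero.mp hF.totalDegree_le)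
    rw [h1, aeval_C, algebraMap_eq] at hFJ
    refine hJ (J.eq_top_of_isUnit_mem hFJ ?_)
    exact (IsUnit.mk0 _ hc).map C
  -- the new coordinates vanish on the line through `c`, on which `F` does not vanish
  let b : Fin (t + 1) → k := fun i => c i / c j
  let y' : Fin t → MvPolynomial (Fin (n + 1)) k := fun i =>
    y (j.succAbove i) - C (b (j.succAbove i)) * y j
  refine ⟨y', fun i => (hy _).sub (by simpa using (isHomogeneous_C _ _).mul (hy j)), ?_⟩
  have hb : eval b F ≠ 0 := by
    have h2 : c = c j • b := by
      ext i
      simp only [Pi.smul_apply, smul_eq_mul, b]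
      field_simp
    rw [h2, hF.eval_smul] at hc
    exact right_ne_zero_of_mul hc
  have hyj : (formsHom y' J).IsIntegralElem (Ideal.Quotient.mk J (y j)) := by
    let a : Fin (t + 1) → MvPolynomial (Fin t) k := Fin.insertNth j 0 X
    let G : Polynomial (MvPolynomial (Fin t) k) :=
      aeval (fun i => Polynomial.C (a i) + Polynomial.C (C (b i)) * Polynomial.X) F
    obtain ⟨hG1, hG2⟩ := Polynomial.natDegree_aeval_linear_le_and_coeff hF a (fun i => C (b i))
    have hlin (i) : aeval y' (a i) + C (b i) * y j = y i := by
      refine Fin.succAboveCases j ?_ (fun i => ?_) i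
      · simp [a, b, hj]
      · simp [a, y']
    have hGJ : G.eval₂ (aeval y' : _ →ₐ[k] MvPolynomial (Fin (n + 1)) k).toRingHom (y j) =
        aeval y F := by
      have : (Polynomial.eval₂AlgHom (aeval y' : _ →ₐ[k] MvPolynomial (Fin (n + 1)) k) (y j)
          (fun _ => Commute.all _ _)).comp
          (aeval (fun i => Polynomial.C (a i) + Polynomial.C (C (b i)) * Polynomial.X)) =
          aeval y := by
        ext1 i
        simp [← hlin i, algebraMap_eq]
      exact DFunLike.congr_fun this F
    have hco : G.coeff m = C (eval b F) := by
      rw [hG2, ← aeval_eq_eval, ← algebraMap_eq, ← aeval_algebraMap_apply]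
      rfl
    -- `G(y_j) = F(y)`, and the coefficient of `T ^ m` in `G` is the nonzero scalar `F(b)`
    refine ⟨Polynomial.C (C (eval b F)⁻¹) * G, ?_, ?_⟩
    · refine Polynomial.monic_of_natDegree_le_of_coeff_eq_one m
        ((Polynomial.natDegree_C_mul_le _ _).trans hG1) ?_
      rw [Polynomial.coeff_C_mul, hco, ← C_mul, inv_mul_cancel₀ hb, C_1]
    · rw [Polynomial.eval₂_mul, eval₂_formsHom_mk G, hGJ, Ideal.Quotient.eq_zero_iff_mem.mpr hFJ,
        mul_zero]
  refine formsHom_isIntegral_of_forall hint fun i => ?_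
  refine Fin.succAboveCases j hyj (fun i => ?_) i
  have h1 : y (j.succAbove i) = y' i + C (b (j.succAbove i)) * y j := by simp [y']
  rw [h1, map_add, map_mul]
  exact (formsHom_isIntegralElem_self i).add _ ((formsHom_isIntegralElem_C _).mul _ hyj)

open MvPolynomial in
/-- Graded Noether normalization over an infinite field: `S / J` is integral over a polynomial ring
in linear forms. -/
theorem exists_linear_noether_normalization [Infinite k]
    {J : Ideal (MvPolynomial (Fin (n + 1)) k)} (hJ : J ≠ ⊤)
    (hhom : J.IsHomogeneous (stdGrading k n)) :
    ∃ (s : ℕ) (y : Fin s → MvPolynomial (Fin (n + 1)) k), (∀ i, (y i).IsHomogeneous 1) ∧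
      Function.Injective (formsHom y J) ∧ (formsHom y J).IsIntegral := by
  classical
  have hex : ∃ s, ∃ y : Fin s → MvPolynomial (Fin (n + 1)) k, (∀ i, (y i).IsHomogeneous 1) ∧
      (formsHom y J).IsIntegral :=
    ⟨n + 1, X, isHomogeneous_X k, formsHom_isIntegral_of_forall_X formsHom_isIntegralElem_self⟩
  -- a minimal number of linear forms over which `S / J` is integral satisfies no relation
  obtain ⟨y, hy, hint⟩ := Nat.find_spec hex
  refine ⟨Nat.find hex, y, hy, ?_, hint⟩
  rw [injective_iff_map_eq_zero]
  intro F hFJ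
  rw [formsHom_eq_zero_iff] at hFJ
  by_contra hF0
  obtain ⟨m, hm⟩ : ∃ m, homogeneousComponent m F ≠ 0 := by
    by_contra! h
    rw [← sum_homogeneousComponent F] at hF0
    exact hF0 (Finset.sum_eq_zero fun i _ => h i)
  have hmJ : aeval y (homogeneousComponent m F) ∈ J := by
    rw [← homogeneousComponent_aeval hy]
    exact hhom.homogeneousComponent_mem hFJ m
  have hFm := homogeneousComponent_isHomogeneous m F
  generalize hs : Nat.find hex = s at *
  cases s with
  | zero =>
    rw [eq_C_of_isEmpty (homogeneousComponent m F), aeval_C, algebraMap_eq] at hmJ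
    refine hJ (J.eq_top_of_isUnit_mem hmJ (IsUnit.map C (IsUnit.mk0 _ fun h0 => hm ?_)))
    rw [eq_C_of_isEmpty (homogeneousComponent m F), h0, C_0]
  | succ t =>
    obtain ⟨y', hy'⟩ := exists_formsHom_isIntegral_of_relation hJ hy hint hFm hm hmJ
    exact Nat.find_min hex (m := t) (by omega) ⟨y', hy'⟩

open MvPolynomial

/-! ### Homogeneous equations of integral dependence -/

/-- `G(T) = T ^ e + a₁ T ^ (e - 1) + ⋯ + a_e` with `aᵢ ∈ k[Y₀, …, Y_{s-1}]` homogeneous of degree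
`i`, and `e > 0`: a homogeneous equation of integral dependence for a linear form. -/
structure Polynomial.IsMonicForm {s : ℕ} (G : Polynomial (MvPolynomial (Fin s) k)) : Prop where
  monic : G.Monic
  natDegree_pos : 0 < G.natDegree
  isHomogeneous_coeff : ∀ i ≤ G.natDegree, (G.coeff i).IsHomogeneous (G.natDegree - i)

/-- The element `G(y₀, …, y_{s-1}; z)` of `k[x₀, …, xₙ]`. -/
abbrev evalForms {s : ℕ} (y : Fin s → MvPolynomial (Fin (n + 1)) k)
    (z : MvPolynomial (Fin (n + 1)) k) (G : Polynomial (MvPolynomial (Fin s) k)) :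
    MvPolynomial (Fin (n + 1)) k :=
  G.eval₂ (MvPolynomial.aeval y : _ →ₐ[k] MvPolynomial (Fin (n + 1)) k).toRingHom z

section

variable {s : ℕ} {y : Fin s → MvPolynomial (Fin (n + 1)) k}
  {z : MvPolynomial (Fin (n + 1)) k}
  {G : Polynomial (MvPolynomial (Fin s) k)}

theorem aeval_mem_span_of_isHomogeneous {F : MvPolynomial (Fin s) k} {m : ℕ}
    (hF : F.IsHomogeneous m) (hm : 0 < m) : aeval y F ∈ Ideal.span (Set.range y) := by
  have hX (i : Fin s) : (X i : MvPolynomial (Fin s) k) ∈ (Ideal.span (Set.range y)).comap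
      (aeval y : _ →ₐ[k] MvPolynomial (Fin (n + 1)) k) := by
    rw [Ideal.mem_comap, aeval_X]
    exact Ideal.subset_span ⟨i, rfl⟩
  exact mem_of_forall_X_mem hX (hF.coeff_zero_eq_zero hm)

theorem Polynomial.IsMonicForm.isHomogeneous_evalForms (hG : G.IsMonicForm)
    (hy : ∀ i, (y i).IsHomogeneous 1) (hz : z.IsHomogeneous 1) :
    (evalForms y z G).IsHomogeneous G.natDegree := by
  rw [evalForms, Polynomial.eval₂_eq_sum_range]
  refine IsHomogeneous.sum _ _ _ fun i hi => ?_
  have hi' : i ≤ G.natDegree := Nat.lt_succ_iff.mp (Finset.mem_range.mp hi)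
  have := ((hG.isHomogeneous_coeff i hi').aeval y hy).mul (hz.pow i)
  rwa [one_mul, one_mul, Nat.sub_add_cancel hi'] at this

theorem Polynomial.IsMonicForm.evalForms_sub_pow_mem (hG : G.IsMonicForm) :
    evalForms y z G - z ^ G.natDegree ∈ Ideal.span (Set.range y) := by
  rw [evalForms, Polynomial.eval₂_eq_sum_range, Finset.sum_range_succ, hG.monic.coeff_natDegree,
    map_one, one_mul, add_sub_cancel_right]
  refine Ideal.sum_mem _ fun i hi => Ideal.mul_mem_right _ _ ?_
  have hi' := Finset.mem_range.mp hi
  exact aeval_mem_span_of_isHomogeneous (hG.isHomogeneous_coeff i hi'.le) (by omega)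

theorem Polynomial.IsMonicForm.isIntegralElem (hG : G.IsMonicForm)
    {J : Ideal (MvPolynomial (Fin (n + 1)) k)} (hGJ : evalForms y z G ∈ J) :
    (formsHom y J).IsIntegralElem (Ideal.Quotient.mk J z) :=
  ⟨G, hG.monic, by rw [eval₂_formsHom_mk, Ideal.Quotient.eq_zero_iff_mem.mpr hGJ]⟩

end

/-- The minimal polynomial of an integral element over a normal domain has least degree among all
nonzero polynomials, monic or not, that annihilate the element. -/
theorem exists_monic_eval₂_eq_zero_minimal {A B : Type*} [CommRing A] [IsDomain A]
    [IsIntegrallyClosed A] [CommRing B] [IsDomain B] {f : A →+* B} (hinj : Function.Injective f)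
    (hint : f.IsIntegral) (b : B) :
    ∃ g : Polynomial A, g.Monic ∧ 0 < g.natDegree ∧ g.eval₂ f b = 0 ∧
      ∀ H : Polynomial A, H ≠ 0 → H.eval₂ f b = 0 → g.natDegree ≤ H.natDegree := by
  algebraize [f]
  have : FaithfulSMul A B := (faithfulSMul_iff_algebraMap_injective A B).mpr hinj
  have hb : IsIntegral A b := hint b
  exact ⟨minpoly A b, minpoly.monic hb, minpoly.natDegree_pos hb, minpoly.aeval A b,
    fun H hH hHb => Polynomial.natDegree_le_natDegree
      (minpoly.IsIntegrallyClosed.degree_le_of_ne_zero hH hHb)⟩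

/-- If `k[y₀, …, y_{s-1}] → S / P` is injective and integral, with `P` a homogeneous prime, then the
minimal polynomial of a linear form over the normal ring `k[y₀, …, y_{s-1}]` has the same degree as
its homogeneous part, which is again an equation of integral dependence. -/
theorem exists_isMonicForm_minimal {P : Ideal (MvPolynomial (Fin (n + 1)) k)} [P.IsPrime]
    (hhom : P.IsHomogeneous (stdGrading k n)) {s : ℕ} {y : Fin s → MvPolynomial (Fin (n + 1)) k}
    (hy : ∀ i, (y i).IsHomogeneous 1) (hinj : Function.Injective (formsHom y P))
    (hint : (formsHom y P).IsIntegral) {z : MvPolynomial (Fin (n + 1)) k}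
    (hz : z.IsHomogeneous 1) :
    ∃ G : Polynomial (MvPolynomial (Fin s) k), G.IsMonicForm ∧ evalForms y z G ∈ P ∧
      ∀ H : Polynomial (MvPolynomial (Fin s) k), H ≠ 0 → evalForms y z H ∈ P →
        G.natDegree ≤ H.natDegree := by
  obtain ⟨g, hmonic, hpos, hg, hmin⟩ :=
    exists_monic_eval₂_eq_zero_minimal hinj hint (Ideal.Quotient.mk P z)
  simp only [eval₂_formsHom_mk, Ideal.Quotient.eq_zero_iff_mem] at hg hmin
  -- the part of `g(y, T)` of degree `deg g`, where `T` and the `y` have degree one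
  let G : Polynomial (MvPolynomial (Fin s) k) := ∑ i ∈ Finset.range (g.natDegree + 1),
    Polynomial.C (homogeneousComponent (g.natDegree - i) (g.coeff i)) * Polynomial.X ^ i
  have hGc (i : ℕ) (hi : i ≤ g.natDegree) :
      G.coeff i = homogeneousComponent (g.natDegree - i) (g.coeff i) := by
    simp only [G, Polynomial.finsetSum_coeff, Polynomial.coeff_C_mul_X_pow]
    rw [Finset.sum_ite_eq, if_pos (by simpa using Nat.lt_succ_iff.mpr hi)]
  have hGle : G.natDegree ≤ g.natDegree :=
    Polynomial.natDegree_sum_le_of_forall_le _ _ fun i hi =>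
      (Polynomial.natDegree_C_mul_X_pow_le _ _).trans
        (Nat.lt_succ_iff.mp (Finset.mem_range.mp hi))
  have hG1 : G.coeff g.natDegree = 1 := by
    rw [hGc _ le_rfl, hmonic.coeff_natDegree, Nat.sub_self, homogeneousComponent_zero]
    simp
  have hdeg : G.natDegree = g.natDegree :=
    Polynomial.natDegree_eq_of_le_of_coeff_ne_zero hGle (by rw [hG1]; exact one_ne_zero)
  refine ⟨G, ⟨?_, ?_, ?_⟩, ?_, ?_⟩
  · rw [Polynomial.Monic, Polynomial.leadingCoeff, hdeg, hG1]
  · rw [hdeg]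
    exact hpos
  · intro i hi
    rw [hdeg] at hi ⊢
    rw [hGc i hi]
    exact homogeneousComponent_isHomogeneous _ _
  · have : evalForms y z G = homogeneousComponent g.natDegree (evalForms y z g) := by
      simp only [evalForms]
      rw [Polynomial.eval₂_eq_sum_range, Polynomial.eval₂_eq_sum_range, hdeg, map_sum]
      refine Finset.sum_congr rfl fun i hi => ?_
      have hi' : i ≤ g.natDegree := Nat.lt_succ_iff.mp (Finset.mem_range.mp hi)
      have h1 := homogeneousComponent_mul_of_isHomogeneous (by simpa using hz.pow i :
        (z ^ i).IsHomogeneous i) (aeval y (g.coeff i)) (g.natDegree - i)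
      rw [Nat.sub_add_cancel hi', homogeneousComponent_aeval hy, ← hGc i hi'] at h1
      exact h1.symm
    rw [this]
    exact hhom.homogeneousComponent_mem hg _
  · intro H hH hHP
    rw [hdeg]
    exact hmin H hH hHP

/-- Modulo `y₀, …, y_{s-1}` a homogeneous equation of integral dependence becomes `z ^ e = 0`. -/
theorem exists_pow_mem_sup_span {P : Ideal (MvPolynomial (Fin (n + 1)) k)} [P.IsPrime]
    (hhom : P.IsHomogeneous (stdGrading k n)) {s : ℕ} {y : Fin s → MvPolynomial (Fin (n + 1)) k}
    (hy : ∀ i, (y i).IsHomogeneous 1) (hinj : Function.Injective (formsHom y P))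
    (hint : (formsHom y P).IsIntegral) {z : MvPolynomial (Fin (n + 1)) k}
    (hz : z.IsHomogeneous 1) : ∃ e, z ^ e ∈ P ⊔ Ideal.span (Set.range y) := by
  obtain ⟨G, hG, hGP, -⟩ := exists_isMonicForm_minimal hhom hy hinj hint hz
  refine ⟨G.natDegree, ?_⟩
  have := sub_mem (Ideal.mem_sup_left hGP : _ ∈ P ⊔ Ideal.span (Set.range y))
    (Ideal.mem_sup_right (hG.evalForms_sub_pow_mem (y := y) (z := z)))
  rwa [sub_sub_cancel] at this

theorem eventually_hilbertFunction_eq_zero {I : Ideal (MvPolynomial (Fin (n + 1)) k)}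
    (h : ∀ i, ∃ e, (X i : MvPolynomial (Fin (n + 1)) k) ^ e ∈ I) :
    ∀ᶠ m in Filter.atTop, hilbertFunction I m = 0 := by
  choose e he using h
  refine Filter.eventually_atTop.mpr ⟨∑ i, e i + 1, fun m hm => hilbertFunction_eq_zero
    fun p hp => ?_⟩
  rw [p.as_sum]
  refine Ideal.sum_mem _ fun d hd => ?_
  have hdeg := hp.degree_eq_sum_deg_support hd
  obtain ⟨i, hi⟩ : ∃ i, e i ≤ d i := by
    by_contra! h0
    have h1 : ∑ i ∈ d.support, d i ≤ ∑ i, d i :=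
      Finset.sum_le_sum_of_subset (Finset.subset_univ _)
    have h2 : ∑ i, d i ≤ ∑ i, e i := Finset.sum_le_sum fun i _ => (h0 i).le
    omega
  have h1 : (X i : MvPolynomial (Fin (n + 1)) k) ^ e i ∣ monomial d (coeff d p) := by
    rw [X_pow_eq_monomial, monomial_dvd_monomial]
    exact ⟨Or.inr (by simpa using hi), one_dvd _⟩
  exact Ideal.mem_of_dvd _ h1 (he i)

/-! ### Complementary linear forms -/

theorem linearIndependent_of_injective_formsHom {s : ℕ}
    {y : Fin s → MvPolynomial (Fin (n + 1)) k} {J : Ideal (MvPolynomial (Fin (n + 1)) k)}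
    (hinj : Function.Injective (formsHom y J)) : LinearIndependent k y := by
  have hker : LinearMap.ker (aeval y : _ →ₐ[k] MvPolynomial (Fin (n + 1)) k).toLinearMap = ⊥ :=
    LinearMap.ker_eq_bot.mpr fun F F' h => hinj (congrArg (Ideal.Quotient.mk J) h)
  have := (linearIndependent_X (Fin s) k).map' _ hker
  have e : ⇑(aeval y : _ →ₐ[k] MvPolynomial (Fin (n + 1)) k).toLinearMap ∘ X = y := by
    ext1 i
    simp
  exact e ▸ this

theorem finrank_homogeneousSubmodule_one (N : ℕ) :
    Module.finrank k (homogeneousSubmodule (Fin N) k 1) = N := by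
  rw [homogeneousSubmodule_one_eq_span_X, finrank_span_eq_card (linearIndependent_X _ _),
    Fintype.card_fin]

theorem exists_complementary_linear_forms {s : ℕ} {y : Fin s → MvPolynomial (Fin (n + 1)) k}
    (hy : ∀ i, (y i).IsHomogeneous 1) (hli : LinearIndependent k y) :
    ∃ (r : ℕ) (z : Fin r → MvPolynomial (Fin (n + 1)) k), r + s = n + 1 ∧
      (∀ j, (z j).IsHomogeneous 1) ∧
      ∀ i, (X i : MvPolynomial (Fin (n + 1)) k) ∈
        Submodule.span k (Set.range y ∪ Set.range z) := by
  let U := Submodule.span k (Set.range y)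
  have hU : U ≤ stdGrading k n 1 := Submodule.span_le.mpr (by rintro _ ⟨i, rfl⟩; exact hy i)
  obtain ⟨V, hd, hsup⟩ := IsModularLattice.exists_disjoint_and_sup_eq hU
  have hV : V ≤ stdGrading k n 1 := hsup ▸ le_sup_right
  have : FiniteDimensional k V := Submodule.finiteDimensional_of_le hV
  have : FiniteDimensional k U := Submodule.finiteDimensional_of_le hU
  let b := Module.finBasis k V
  have hspan : Submodule.span k (Set.range fun j => (b j : MvPolynomial (Fin (n + 1)) k)) = V := by
    have : (Set.range fun j => (b j : MvPolynomial (Fin (n + 1)) k)) =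
        V.subtype '' Set.range b := by rw [← Set.range_comp]; rfl
    rw [this, ← Submodule.map_span, b.span_eq, Submodule.map_top, Submodule.range_subtype]
  refine ⟨Module.finrank k V, fun j => b j, ?_, fun j => hV (b j).2, fun i => ?_⟩
  · have h1 := Submodule.finrank_sup_add_finrank_inf_eq U V
    rw [hsup, hd.eq_bot, finrank_bot, finrank_homogeneousSubmodule_one,
      finrank_span_eq_card hli, Fintype.card_fin] at h1
    omega
  · rw [Submodule.span_union, hspan]
    change X i ∈ U ⊔ V
    exact hsup ▸ isHomogeneous_X k i

theorem formsHom_isIntegral_of_span {s r : ℕ} {y : Fin s → MvPolynomial (Fin (n + 1)) k}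
    {z : Fin r → MvPolynomial (Fin (n + 1)) k}
    (hspan : ∀ i, (X i : MvPolynomial (Fin (n + 1)) k) ∈
        Submodule.span k (Set.range y ∪ Set.range z))
    {J : Ideal (MvPolynomial (Fin (n + 1)) k)}
    (hz : ∀ j, (formsHom y J).IsIntegralElem (Ideal.Quotient.mk J (z j))) :
    (formsHom y J).IsIntegral := by
  refine formsHom_isIntegral_of_forall_X fun i => ?_
  refine Submodule.span_induction (p := fun x _ =>
    (formsHom y J).IsIntegralElem (Ideal.Quotient.mk J x)) ?_ ?_ ?_ ?_ (hspan i)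
  · rintro _ (⟨i, rfl⟩ | ⟨j, rfl⟩)
    · exact formsHom_isIntegralElem_self i
    · exact hz j
  · rw [map_zero]
    exact RingHom.isIntegralElem_zero _
  · intro a b _ _ ha hb
    rw [map_add]
    exact ha.add _ hb
  · intro c a _ ha
    rw [smul_eq_C_mul, map_mul]
    exact (formsHom_isIntegralElem_C c).mul _ ha

/-- Incomparability for the integral extension `k[y₀, …, y_{s-1}] → S / J`. -/
theorem comap_aeval_lt_comap_aeval {s : ℕ} {y : Fin s → MvPolynomial (Fin (n + 1)) k}
    {J : Ideal (MvPolynomial (Fin (n + 1)) k)} (hint : (formsHom y J).IsIntegral)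
    {Q Q' : Ideal (MvPolynomial (Fin (n + 1)) k)} [Q.IsPrime] (hJ : J ≤ Q) (hQ : Q < Q') :
    Q.comap (aeval y : _ →ₐ[k] MvPolynomial (Fin (n + 1)) k).toRingHom <
      Q'.comap (aeval y : _ →ₐ[k] MvPolynomial (Fin (n + 1)) k).toRingHom := by
  obtain ⟨hle, x, hx, hxQ⟩ := SetLike.lt_iff_le_and_exists.mp hQ
  obtain ⟨p, hp, hp0⟩ := hint (Ideal.Quotient.mk J x)
  rw [eval₂_formsHom_mk, Ideal.Quotient.eq_zero_iff_mem] at hp0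
  exact Ideal.comap_lt_comap_of_root_mem_sdiff hle ⟨hx, hxQ⟩
    (Polynomial.map_monic_ne_zero hp) (hJ hp0)

/-! ### Dimension of projective zero loci -/

instance quasiSober_projectiveSpectrum : QuasiSober (ProjectiveSpectrum (stdGrading k n)) :=
  inferInstanceAs (QuasiSober (projSpace k n))

instance t0Space_projectiveSpectrum : T0Space (ProjectiveSpectrum (stdGrading k n)) :=
  inferInstanceAs (T0Space (projSpace k n))

/-- In a sober space the irreducible closed subsets are the closures of the points, with inclusions
corresponding to specializations. -/
theorem topologicalKrullDim_eq_krullDim_of_specializes {T : Type*} [TopologicalSpace T]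
    [QuasiSober T] [T0Space T] [PartialOrder T] (h : ∀ x y : T, x ≤ y ↔ x ⤳ y) :
    topologicalKrullDim T = Order.krullDim T := by
  let e : T ≃o (TopologicalSpace.IrreducibleCloseds T)ᵒᵈ :=
    { irreducibleSetEquivPoints.toEquiv.symm.trans OrderDual.toDual with
      map_rel_iff' := fun {p q} => (RelIso.symm irreducibleSetEquivPoints).map_rel_iff.trans
        (h p q).symm }
  rw [Order.krullDim_eq_of_orderIso e, Order.krullDim_orderDual]
  rfl

theorem ProjectiveSpectrum.le_iff_specializes {A σ : Type*} [CommRing A] [SetLike σ A]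
    [AddSubmonoidClass σ A] {𝒜 : ℕ → σ} [GradedRing 𝒜] (x y : ProjectiveSpectrum 𝒜) :
    x ≤ y ↔ x ⤳ y := by
  rw [ProjectiveSpectrum.le_iff_mem_closure, specializes_iff_mem_closure]

theorem topologicalKrullDim_zeroLocus (T : Set (MvPolynomial (Fin (n + 1)) k)) :
    topologicalKrullDim (ProjectiveSpectrum.zeroLocus (stdGrading k n) T) =
      Order.krullDim (ProjectiveSpectrum.zeroLocus (stdGrading k n) T) := by
  have : QuasiSober (ProjectiveSpectrum.zeroLocus (stdGrading k n) T) :=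
    (ProjectiveSpectrum.isClosed_zeroLocus _ T).isClosedEmbedding_subtypeVal.quasiSober
  refine topologicalKrullDim_eq_krullDim_of_specializes fun x y => ?_
  rw [subtype_specializes_iff, ← ProjectiveSpectrum.le_iff_specializes]
  rfl

theorem coeff_zero_eq_zero_of_mem_irrelevant {p : MvPolynomial (Fin (n + 1)) k}
    (hp : p ∈ HomogeneousIdeal.irrelevant (stdGrading k n)) : coeff 0 p = 0 := by
  have hp0 : homogeneousComponent 0 p = 0 := by
    rw [← decomposition.decompose'_apply]
    exact hp
  rwa [homogeneousComponent_zero, C_eq_zero] at hp0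

theorem toIdeal_lt_ker_constantCoeff (x : ProjectiveSpectrum (stdGrading k n)) :
    x.asHomogeneousIdeal.toIdeal <
      RingHom.ker (constantCoeff : MvPolynomial (Fin (n + 1)) k →+* k) := by
  refine lt_of_le_of_ne (fun p hp => ?_) fun h => x.not_irrelevant_le fun p hp => ?_
  · by_contra h0
    rw [RingHom.mem_ker, constantCoeff_eq] at h0
    have h1 := x.asHomogeneousIdeal.isHomogeneous.homogeneousComponent_mem hp 0
    rw [homogeneousComponent_zero] at h1
    exact x.isPrime.ne_top (Ideal.eq_top_of_isUnit_mem _ h1 ((IsUnit.mk0 _ h0).map C))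
  · rw [← HomogeneousIdeal.mem_iff, h]
    exact coeff_zero_eq_zero_of_mem_irrelevant hp

/-- If `S / (T)` is integral over `k[y₀, …, y_{s-1}]`, then `dim V₊(T) < s`: contraction embeds the
chains of relevant homogeneous primes containing `T`, extended by the irrelevant ideal, into those
of `Spec k[Y₀, …, Y_{s-1}]`. -/
theorem krullDim_zeroLocus_add_one_le {s : ℕ} {y : Fin s → MvPolynomial (Fin (n + 1)) k}
    {T : Set (MvPolynomial (Fin (n + 1)) k)} (hint : (formsHom y (Ideal.span T)).IsIntegral)
    [Nonempty (ProjectiveSpectrum.zeroLocus (stdGrading k n) T)] :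
    Order.krullDim (ProjectiveSpectrum.zeroLocus (stdGrading k n) T) + 1 ≤ s := by
  rw [← Order.krullDim_WithTop]
  let m : PrimeSpectrum (MvPolynomial (Fin (n + 1)) k) :=
    ⟨RingHom.ker constantCoeff, RingHom.ker_isPrime _⟩
  let g : WithTop (ProjectiveSpectrum.zeroLocus (stdGrading k n) T) →
      PrimeSpectrum (MvPolynomial (Fin (n + 1)) k) :=
    fun x => x.recTopCoe m fun x => ⟨x.1.asHomogeneousIdeal.toIdeal, x.1.isPrime⟩
  have hlt (x x' : PrimeSpectrum (MvPolynomial (Fin (n + 1)) k))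
      (hx : T ⊆ x.asIdeal) (h : x.asIdeal < x'.asIdeal) :
      PrimeSpectrum.comap (aeval y : _ →ₐ[k] MvPolynomial (Fin (n + 1)) k).toRingHom x <
        PrimeSpectrum.comap (aeval y : _ →ₐ[k] MvPolynomial (Fin (n + 1)) k).toRingHom x' :=
    comap_aeval_lt_comap_aeval hint (Ideal.span_le.mpr hx) h
  have hmono : StrictMono fun x => PrimeSpectrum.comap
      (aeval y : _ →ₐ[k] MvPolynomial (Fin (n + 1)) k).toRingHom (g x) := by
    intro a b hab
    induction a with
    | top => exact absurd hab not_top_lt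
    | coe a =>
      induction b with
      | top => exact hlt _ _ a.2 (toIdeal_lt_ker_constantCoeff a.1)
      | coe b => exact hlt _ _ a.2 (show a < b from WithTop.coe_lt_coe.mp hab)
  refine (Order.krullDim_le_of_strictMono _ hmono).trans (le_of_eq ?_)
  have := MvPolynomial.ringKrullDim_of_isNoetherianRing (R := k) (ι := Fin s)
  rw [ringKrullDim_eq_zero_of_field, zero_add, Nat.card_eq_fintype_card, Fintype.card_fin] at this
  exact this

/-- The prime ideal `(Y₀, …, Y_{j-1})` of `k[Y₀, …, Y_{s-1}]`, as the kernel of the endomorphism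
that sends these variables to zero and fixes the others. -/
def coordPrime (k : Type u) [Field k] (s j : ℕ) : PrimeSpectrum (MvPolynomial (Fin s) k) :=
  ⟨RingHom.ker (aeval (fun i : Fin s => if (i : ℕ) < j then 0 else X i) :
    MvPolynomial (Fin s) k →ₐ[k] MvPolynomial (Fin s) k), RingHom.ker_isPrime _⟩

theorem X_mem_coordPrime {s j : ℕ} {i : Fin s} :
    (X i : MvPolynomial (Fin s) k) ∈ (coordPrime k s j).asIdeal ↔ (i : ℕ) < j := by
  simp [coordPrime, RingHom.mem_ker]

theorem coordPrime_mono {s j j' : ℕ} (h : j ≤ j') :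
    (coordPrime k s j).asIdeal ≤ (coordPrime k s j').asIdeal := by
  intro p hp
  have hc : (aeval (fun i : Fin s => if (i : ℕ) < j' then 0 else X i) :
      MvPolynomial (Fin s) k →ₐ[k] MvPolynomial (Fin s) k) =
      (aeval (fun i : Fin s => if (i : ℕ) < j' then 0 else X i)).comp
        (aeval (fun i : Fin s => if (i : ℕ) < j then 0 else X i)) := by
    ext1 i
    rcases lt_or_ge (i : ℕ) j with h1 | h1
    · simp [h1, h1.trans_le h]
    · simp [not_lt.mpr h1]
  change aeval _ p = 0 at hp
  change aeval _ p = 0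
  rw [hc, AlgHom.comp_apply, hp, map_zero]

/-- Going up along the primes `(Y₀, …, Y_{j-1})` gives a chain of primes of `S` above `P`. Their
homogeneous cores are prime and contain the same `yᵢ`, so they still form a strict chain, and `y_d`
keeps them relevant. -/
theorem exists_chain_zeroLocus {d : ℕ} {y : Fin (d + 1) → MvPolynomial (Fin (n + 1)) k}
    (hy : ∀ i, (y i).IsHomogeneous 1) {P : Ideal (MvPolynomial (Fin (n + 1)) k)} [P.IsPrime]
    (hinj : Function.Injective (formsHom y P)) (hint : (formsHom y P).IsIntegral)
    (hhom : P.IsHomogeneous (stdGrading k n)) :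
    ∃ q : Fin (d + 1) → ProjectiveSpectrum (stdGrading k n), StrictMono q ∧
      ∀ j, P ≤ (q j).asHomogeneousIdeal.toIdeal := by
  have hstep (I : Ideal (MvPolynomial (Fin (n + 1)) k)) [I.IsPrime] (hPI : P ≤ I) (j : ℕ)
      (hI : I.comap (aeval y : _ →ₐ[k] MvPolynomial (Fin (n + 1)) k).toRingHom ≤
        (coordPrime k (d + 1) j).asIdeal) :
      ∃ Q, I ≤ Q ∧ Q.IsPrime ∧
        Q.comap (aeval y : _ →ₐ[k] MvPolynomial (Fin (n + 1)) k).toRingHom =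
          (coordPrime k (d + 1) j).asIdeal := by
    algebraize [formsHom y P]
    obtain ⟨Q, hQ1, hQ2, hQ3⟩ := Ideal.exists_ideal_over_prime_of_isIntegral
      (coordPrime k (d + 1) j).asIdeal (I.map (Ideal.Quotient.mk P)) (by
        change Ideal.comap (Ideal.Quotient.mk P |>.comp
          (aeval y : _ →ₐ[k] MvPolynomial (Fin (n + 1)) k).toRingHom) _ ≤ _
        rw [← Ideal.comap_comap, Ideal.comap_map_mk hPI]
        exact hI)
    refine ⟨Q.comap (Ideal.Quotient.mk P), ?_, Ideal.comap_isPrime _ _, ?_⟩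
    · rw [← Ideal.map_le_iff_le_comap]
      exact hQ1
    · rw [Ideal.comap_comap]
      exact hQ3
  -- the primes above `P` that lie over the `j`-th coordinate prime
  let T (j : ℕ) := { Q : Ideal (MvPolynomial (Fin (n + 1)) k) // Q.IsPrime ∧ P ≤ Q ∧
    Q.comap (aeval y : _ →ₐ[k] MvPolynomial (Fin (n + 1)) k).toRingHom =
      (coordPrime k (d + 1) j).asIdeal }
  have hnext (j : ℕ) (I : T j) : ∃ Q : T (j + 1), I.1 ≤ Q.1 := by
    obtain ⟨I, hI, hPI, hIc⟩ := I
    obtain ⟨Q, h1, h2, h3⟩ := hstep I hPI (j + 1) (hIc ▸ coordPrime_mono (Nat.le_succ j))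
    exact ⟨⟨Q, h2, hPI.trans h1, h3⟩, h1⟩
  choose next hle using hnext
  have h0 : P.comap (aeval y : _ →ₐ[k] MvPolynomial (Fin (n + 1)) k).toRingHom =
      (coordPrime k (d + 1) 0).asIdeal := by
    ext F
    have h1 : F ∈ (coordPrime k (d + 1) 0).asIdeal ↔ F = 0 := by
      simp [coordPrime, RingHom.mem_ker]
    rw [h1, ← map_eq_zero_iff _ hinj, formsHom_eq_zero_iff]
    rfl
  let Q (j : ℕ) : T j := Nat.rec ⟨P, ‹_›, le_rfl, h0⟩ (fun j I => next j I) j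
  have hQmono : Monotone fun j => (Q j).1 := monotone_nat_of_le_succ fun j => hle j (Q j)
  have hyQ (i : Fin (d + 1)) (j : ℕ) :
      y i ∈ ((Q j).1.homogeneousCore (stdGrading k n)).toIdeal ↔ (i : ℕ) < j := by
    have hQj := (Q j).2.2.2
    rw [← X_mem_coordPrime (k := k)]
    simp only [← hQj, Ideal.mem_comap]
    have : (aeval y : _ →ₐ[k] MvPolynomial (Fin (n + 1)) k).toRingHom (X i) = y i := aeval_X y i
    simp only [this]
    exact ⟨fun h => Ideal.toIdeal_homogeneousCore_le _ _ h,
      fun h => Ideal.mem_homogeneousCore_of_homogeneous_of_mem ⟨1, hy i⟩ h⟩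
  refine ⟨fun j => ⟨(Q j).1.homogeneousCore (stdGrading k n), (Q j).2.1.homogeneousCore,
    fun hirr => ?_⟩, fun j j' hjj' => ?_, fun j => ?_⟩
  · have h1 := hirr (HomogeneousIdeal.mem_irrelevant_of_mem (stdGrading k n) one_pos
      (hy (Fin.last d)))
    have h2 := (hyQ (Fin.last d) j).mp h1
    rw [Fin.val_last] at h2
    omega
  · refine lt_of_le_of_ne (Ideal.homogeneousCore_mono _ (hQmono hjj'.le)) fun heq => ?_
    have h1 := (hyQ j j').mpr hjj'
    have h2 : ((Q j).1.homogeneousCore (stdGrading k n)) =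
      ((Q j').1.homogeneousCore (stdGrading k n)) := congrArg (·.asHomogeneousIdeal) heq
    rw [← h2] at h1
    exact absurd ((hyQ j j).mp h1) (lt_irrefl _)
  · exact hhom.toIdeal_homogeneousCore_eq_self.symm.le.trans
      (Ideal.homogeneousCore_mono (stdGrading k n) (Q j).2.2.1)

/-- The dimension of `V₊(T)`, if the polynomial ring in the linear forms `y₀, …, y_d` makes the
ring `S / (T)` integral and meets some homogeneous prime `P ⊇ T` in zero. -/
theorem topologicalKrullDim_zeroLocus_eq {d : ℕ} {y : Fin (d + 1) → MvPolynomial (Fin (n + 1)) k}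
    (hy : ∀ i, (y i).IsHomogeneous 1) {P : Ideal (MvPolynomial (Fin (n + 1)) k)} [P.IsPrime]
    (hhom : P.IsHomogeneous (stdGrading k n)) (hinj : Function.Injective (formsHom y P))
    (hintP : (formsHom y P).IsIntegral) {T : Set (MvPolynomial (Fin (n + 1)) k)}
    (hSP : T ⊆ P) (hint : (formsHom y (Ideal.span T)).IsIntegral) :
    topologicalKrullDim (ProjectiveSpectrum.zeroLocus (stdGrading k n) T) = d := by
  obtain ⟨q, hq, hPq⟩ := exists_chain_zeroLocus hy hinj hintP hhom
  let q' : Fin (d + 1) → ProjectiveSpectrum.zeroLocus (stdGrading k n) T :=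
    fun j => ⟨q j, fun p hp => hPq j (hSP hp)⟩
  have : Nonempty (ProjectiveSpectrum.zeroLocus (stdGrading k n) T) := ⟨q' 0⟩
  rw [topologicalKrullDim_zeroLocus]
  refine le_antisymm ?_ ?_
  · have h := krullDim_zeroLocus_add_one_le hint
    push_cast at h
    exact ENat.WithBot.add_le_add_one_right_iff.mp h
  · exact Order.LTSeries.length_le_krullDim (LTSeries.mk d q' hq)

/-! ### Complete intersections through a subvariety -/

theorem pos_of_formsHom_isIntegral {P : ProjectiveSpectrum (stdGrading k n)} {s : ℕ}
    {y : Fin s → MvPolynomial (Fin (n + 1)) k} (hy : ∀ i, (y i).IsHomogeneous 1)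
    (hinj : Function.Injective (formsHom y P.asHomogeneousIdeal.toIdeal))
    (hint : (formsHom y P.asHomogeneousIdeal.toIdeal).IsIntegral) : 0 < s := by
  rcases Nat.eq_zero_or_pos s with rfl | hs
  swap
  · exact hs
  -- with no `y` at all, every variable would be nilpotent modulo `P`
  have hX (i : Fin (n + 1)) : X i ∈ P.asHomogeneousIdeal.toIdeal := by
    obtain ⟨e, he⟩ := exists_pow_mem_sup_span P.asHomogeneousIdeal.isHomogeneous hy hinj hint
      (isHomogeneous_X k i)
    rw [Set.range_eq_empty, Ideal.span_empty, sup_bot_eq] at he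
    exact P.isPrime.mem_of_pow_mem _ he
  exact absurd (fun p hp => mem_of_forall_X_mem hX (coeff_zero_eq_zero_of_mem_irrelevant hp))
    P.not_irrelevant_le

/-- Incomparability makes the closure of a point `P` an irreducible component of any `V₊(T)`
containing it with `S / (T)` integral over a polynomial subring that meets `P` in zero. -/
theorem closure_mem_irreducibleComponents_zeroLocus {s : ℕ}
    {y : Fin s → MvPolynomial (Fin (n + 1)) k} {P : ProjectiveSpectrum (stdGrading k n)}
    (hinj : Function.Injective (formsHom y P.asHomogeneousIdeal.toIdeal))
    {T : Set (MvPolynomial (Fin (n + 1)) k)} (hSP : P ∈ ProjectiveSpectrum.zeroLocus _ T)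
    (hint : (formsHom y (Ideal.span T)).IsIntegral) :
    ∃ Z ∈ irreducibleComponents (ProjectiveSpectrum.zeroLocus (stdGrading k n) T),
      Subtype.val '' Z = closure {P} := by
  set W := ProjectiveSpectrum.zeroLocus (stdGrading k n) T
  have hW : IsClosed W := ProjectiveSpectrum.isClosed_zeroLocus _ T
  have : QuasiSober W := hW.isClosedEmbedding_subtypeVal.quasiSober
  let x : W := ⟨P, hSP⟩
  have hcl : Subtype.val '' closure {x} = closure {P} := by
    rw [← hW.isClosedEmbedding_subtypeVal.closure_image_eq, Set.image_singleton]
  refine ⟨closure {x}, ⟨isIrreducible_singleton.closure, fun Z hZ hxZ => ?_⟩, hcl⟩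
  obtain ⟨q, hq⟩ := QuasiSober.sober hZ.closure isClosed_closure
  have hqx : q ⤳ x := by
    rw [specializes_iff_mem_closure, hq.def]
    exact subset_closure (hxZ (subset_closure rfl))
  rw [subtype_specializes_iff, ← ProjectiveSpectrum.le_iff_specializes] at hqx
  have hqP : (q : ProjectiveSpectrum (stdGrading k n)) = P := by
    by_contra hne
    have hlt := comap_aeval_lt_comap_aeval hint (Q := q.1.asHomogeneousIdeal.toIdeal)
      (Q' := P.asHomogeneousIdeal.toIdeal) (Ideal.span_le.mpr q.2)
      (show q.1 < P from lt_of_le_of_ne hqx hne)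
    refine hlt.not_ge fun F hF => ?_
    have hF0 : F = 0 := by
      rw [← map_eq_zero_iff _ hinj, formsHom_eq_zero_iff]
      exact hF
    rw [hF0]
    exact zero_mem _
  have hqx' : q = x := Subtype.ext hqP
  rw [← hqx', hq.def]
  exact subset_closure

/-- The subvariety `closure {P}` of projective space is a component of a complete intersection of
hypersurfaces `G_j(y, z_j) = 0`, where the linear forms `y` normalize `S / P`, the `z_j` complete
them to coordinates, and `G_j` is the minimal equation of `z_j` over `k[y]` modulo `P`. -/
theorem exists_completeIntersection_of_point [Infinite k]
    (P : ProjectiveSpectrum (stdGrading k n)) :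
    ∃ (r : ℕ) (f : Fin r → MvPolynomial (Fin (n + 1)) k) (e : Fin r → ℕ),
      IsCompleteIntersection f e ∧
      (∀ j, (e j : ℚ) ≤
        ((hilbertPolynomial P.asHomogeneousIdeal.toIdeal).natDegree.factorial : ℚ) *
          (hilbertPolynomial P.asHomogeneousIdeal.toIdeal).leadingCoeff) ∧
      ∃ Z ∈ irreducibleComponents
        (ProjectiveSpectrum.zeroLocus (stdGrading k n) (Set.range f)),
        Subtype.val '' Z = closure {P} := by
  have hhom := P.asHomogeneousIdeal.isHomogeneous
  set I := P.asHomogeneousIdeal.toIdeal with hI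
  obtain ⟨s, y, hy, hinj, hintP⟩ := exists_linear_noether_normalization P.isPrime.ne_top hhom
  obtain ⟨d, rfl⟩ := Nat.exists_eq_succ_of_ne_zero
    (pos_of_formsHom_isIntegral hy hinj hintP).ne'
  obtain ⟨r, z, hrs, hz, hspan⟩ :=
    exists_complementary_linear_forms hy (linearIndependent_of_injective_formsHom hinj)
  choose G hG hGP hmin using fun j => exists_isMonicForm_minimal hhom hy hinj hintP (hz j)
  let f : Fin r → MvPolynomial (Fin (n + 1)) k := fun j => evalForms y (z j) (G j)
  have hfP : Set.range f ⊆ I := by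
    rintro _ ⟨j, rfl⟩
    exact hGP j
  have hint : (formsHom y (Ideal.span (Set.range f))).IsIntegral :=
    formsHom_isIntegral_of_span hspan fun j =>
      (hG j).isIntegralElem (Ideal.subset_span ⟨j, rfl⟩)
  refine ⟨r, f, fun j => (G j).natDegree,
    ⟨fun j => (hG j).isHomogeneous_evalForms hy (hz j), fun j => (hG j).natDegree_pos, ?_⟩,
    fun j => ?_, closure_mem_irreducibleComponents_zeroLocus hinj hfP hint⟩
  · have h := topologicalKrullDim_zeroLocus_eq hy hhom hinj hintP hfP hint
    change topologicalKrullDim (ProjectiveSpectrum.zeroLocus (stdGrading k n) (Set.range f)) + _ = _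
    rw [h]
    have : d + r = n := by omega
    exact_mod_cast this
  · exact le_factorial_mul_leadingCoeff_hilbertPolynomial (hG j).natDegree_pos hhom hy
      (eventually_hilbertFunction_eq_zero fun i =>
        exists_pow_mem_sup_span hhom hy hinj hintP (isHomogeneous_X k i)) (hz j) (hmin j)

end
theorem mainTheorem11 {k : Type u} [Field k] [IsAlgClosed k] (n : ℕ) {X : Scheme.{u}}
    [IsIntegral X] (i : X ⟶ projSpace k n) [IsClosedImmersion i]
    (hX : Set.range i ≠ Set.univ) :
    ∃ (r : ℕ) (f : Fin r → MvPolynomial (Fin (n + 1)) k) (e : Fin r → ℕ),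
      IsCompleteIntersection f e ∧
      (∀ j, (e j : ℚ) ≤ subvarietyDegree i) ∧
      ∃ Z ∈ irreducibleComponents (projZeroLocus f), Subtype.val '' Z = Set.range i := by
  have : Infinite k := IsAlgClosed.instInfinite
  -- the generic point of `X` is the homogeneous prime ideal `I(X)`
  obtain ⟨P, hP⟩ : ∃ P : ProjectiveSpectrum (stdGrading k n), closure {P} = Set.range i := by
    have hirr : IsIrreducible (Set.range i) := by
      rw [← Set.image_univ]
      exact (IrreducibleSpace.isIrreducible_univ X).image _ i.continuous.continuousOn
    exact QuasiSober.sober hirr (Scheme.Hom.isClosedEmbedding i).isClosed_range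
  have hI : ProjectiveSpectrum.vanishingIdeal (𝒜 := stdGrading k n) (Set.range i) =
      P.asHomogeneousIdeal := by
    refine (congrArg (ProjectiveSpectrum.vanishingIdeal (𝒜 := stdGrading k n)) hP.symm).trans ?_
    rw [ProjectiveSpectrum.vanishingIdeal_closure, ProjectiveSpectrum.vanishingIdeal_singleton]
  have hdeg : subvarietyDegree i =
      ((hilbertPolynomial P.asHomogeneousIdeal.toIdeal).natDegree.factorial : ℚ) *
        (hilbertPolynomial P.asHomogeneousIdeal.toIdeal).leadingCoeff := by
    rw [← hI]
    rfl
  rw [hdeg, ← hP]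
  exact exists_completeIntersection_of_point P
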